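/- \textbf{Lemma.} For every $\kappa_0>0$ there are constants $c_1,c_2>0$, depending only on $\kappa_0$, such that the following holds. Let $H\ge 1$, $n_0\ge 1$, $T\ge 1$ and $m\ge 0$ be integers, let $\kappa\ge\kappa_0$ be real, and let $\delta\in(0,1)$ with $T/\delta\ge 2$ (automatic if $T\ge 2$). Let $w_0,\dots,w_{m-1}$ be independent random variables with $w_k\sim\mathrm{Beta}\big(\tfrac{H+1}{\kappa},\tfrac{n_0+k}{\kappa}\big)$, and define the aggregated weights $$W_m^0=\prod_{k=0}^{m-1}(1-w_k),\qquad W_m^i=w_{i-1}\prod_{k=i}^{m-1}(1-w_k)\quad(1\le i\le m).$$ Let $\lambda_0,\lambda_1,\dots,\lambda_m\in[0,1]$ be fixed real numbers. Then, with probability at least $1-\frac{\delta}{T}$, $$\left|\sum_{i=0}^m\lambda_i\big(W_m^i-\mathbb E[W_m^i]\big)\right|\le c_1\sqrt{\frac{(H+1)\,\kappa^2\log^3(T/\delta)}{H+n_0+m}}+c_2\,\frac{(H+1)\,\kappa\log^2(T/\delta)}{H+n_0+m}.$$ In particular $c_1,c_2$ are universal as soon as $\kappa$ is bounded below by a universal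 constant, for example for $\kappa\ge 1$. -/

import Mathlib

open MeasureTheory ProbabilityTheory

/-- The aggregated weights `W_m^i`, `0 ≤ i ≤ m`, built from the learning rates `w_0, …, w_{m-1}`:
`W_m^0 = ∏_{k=0}^{m-1} (1 - w_k)` and `W_m^i = w_{i-1} ∏_{k=i}^{m-1} (1 - w_k)` for `1 ≤ i ≤ m`. -/
def aggregatedWeight (w : ℕ → ℝ) (m : ℕ) : ℕ → ℝ
  | 0 => ∏ k ∈ Finset.range m, (1 - w k)
  | i + 1 => w i * ∏ k ∈ Finset.Ico (i + 1) m, (1 - w k)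

/-! ### Moments of the beta distribution -/

/-! The sum S_m = ∑ λ_i W_m^i satisfies S_{m+1} = (1 - w_m) S_m + w_m λ_{m+1}, with w_m independent
of S_m. With h = E[w_m] and d = λ_{m+1} - E[S_m], the centred sum obeys X' = (1 - w_m) X + (w_m - h)
d.

Expand X'^{2p} to second order around X. By independence and centring, the linear term contributes
exactly -2p h E[X^{2p}]. The quadratic remainder is controlled by the beta moments E[w^{j+1}] ≤ h
ρ^j, where ρ = D/M, D = H + 1 + 2pκ and M = H + 1 + n₀ + m (`integral_pow_convex_step_le`). The
contraction absorbs this noise and still leaves room to replace M by M + 1 (`moment_recursion_le`),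
so E[X^{2p}] ≤ (384 p D / M)^p by induction on m (`integral_pow_weightedSum_sub_le`).

Markov's inequality with p = ⌈log(T/δ)⌉ concludes: p and D/κ are then of order log(T/δ), up to
constants depending on H and κ₀, and crude use of κ ≥ κ₀ and log(T/δ) ≥ 1/2 gives the stated scale.
-/

lemma pow_mul_betaPDF {a b : ℝ} (ha : 0 < a) (hb : 0 < b) (j : ℕ) (x : ℝ) :
    betaPDF a b x * ENNReal.ofReal (x ^ j) =
      ENNReal.ofReal (beta (a + j) b / beta a b) * betaPDF (a + j) b x := by
  have h1 := beta_pos ha hb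
  have h2 := beta_pos (show 0 < a + j by positivity) hb
  by_cases hx : 0 < x ∧ x < 1
  · have hx0 := hx.1
    have hx1 : 0 < 1 - x := by linarith [hx.2]
    rw [betaPDF_of_pos_lt_one hx.1 hx.2, betaPDF_of_pos_lt_one hx.1 hx.2,
      ← ENNReal.ofReal_mul (by positivity), ← ENNReal.ofReal_mul (by positivity)]
    congr 1
    rw [show a + j - 1 = (a - 1) + (j : ℝ) by ring, Real.rpow_add hx0, Real.rpow_natCast]
    field_simp
  · simp [betaPDF_eq, hx]

lemma ae_betaMeasure_mem_Icc (a b : ℝ) : ∀ᵐ x ∂betaMeasure a b, x ∈ Set.Icc (0 : ℝ) 1 := by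
  rw [betaMeasure, ae_withDensity_iff (by unfold betaPDF; fun_prop)]
  refine Filter.Eventually.of_forall fun x hx => ?_
  by_contra h
  rw [Set.mem_Icc, not_and_or, not_le, not_le] at h
  rcases h with h | h
  · exact hx (betaPDF_eq_zero_of_nonpos h.le)
  · exact hx (betaPDF_eq_zero_of_one_le h.le)

lemma integral_pow_betaMeasure {a b : ℝ} (ha : 0 < a) (hb : 0 < b) (j : ℕ) :
    ∫ x, x ^ j ∂betaMeasure a b = beta (a + j) b / beta a b := by
  have h1 := beta_pos ha hb
  have h2 := beta_pos (show 0 < a + j by positivity) hb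
  have hm : ∀ a, Measurable (betaPDF a b) := fun a => by unfold betaPDF; fun_prop
  rw [integral_eq_lintegral_of_nonneg_ae
    ((ae_betaMeasure_mem_Icc a b).mono fun x hx => pow_nonneg hx.1 j) (by fun_prop),
    betaMeasure, lintegral_withDensity_eq_lintegral_mul _ (hm a) (by fun_prop)]
  simp only [Pi.mul_apply, pow_mul_betaPDF ha hb]
  rw [lintegral_const_mul _ (hm _), lintegral_betaPDF_eq_one (by positivity) hb, mul_one,
    ENNReal.toReal_ofReal (by positivity)]

lemma beta_add_one_left {a b : ℝ} (ha : 0 < a) (hb : 0 < b) :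
    beta (a + 1) b = a / (a + b) * beta a b := by
  have := Real.Gamma_pos_of_pos (add_pos ha hb)
  rw [beta, beta, Real.Gamma_add_one ha.ne', show a + 1 + b = a + b + 1 by ring,
    Real.Gamma_add_one (by positivity)]
  field_simp

lemma integral_pow_succ_betaMeasure {a b : ℝ} (ha : 0 < a) (hb : 0 < b) (j : ℕ) :
    ∫ x, x ^ (j + 1) ∂betaMeasure a b =
      (a + j) / (a + j + b) * ∫ x, x ^ j ∂betaMeasure a b := by
  rw [integral_pow_betaMeasure ha hb, integral_pow_betaMeasure ha hb, Nat.cast_succ,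
    ← add_assoc, beta_add_one_left (by positivity) hb, mul_div_assoc]

lemma integral_betaMeasure {a b : ℝ} (ha : 0 < a) (hb : 0 < b) :
    ∫ x, x ∂betaMeasure a b = a / (a + b) := by
  have := isProbabilityMeasureBeta ha hb
  simpa using integral_pow_succ_betaMeasure ha hb 0

/-- Consecutive moments have ratio (a + i)/(a + i + b) ≤ (a + q)/(a + b). The uniform ratio makes
the binomial sum over moments collapse into a single power later. -/
lemma integral_pow_betaMeasure_le {a b : ℝ} (ha : 0 < a) (hb : 0 < b) {q j : ℕ} (hj : j ≤ q) :
    ∫ x, x ^ (j + 1) ∂betaMeasure a b ≤ a / (a + b) * ((a + q) / (a + b)) ^ j := by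
  induction j with
  | zero => simp [integral_betaMeasure ha hb]
  | succ j ih =>
    have hnn : 0 ≤ ∫ x, x ^ (j + 1) ∂betaMeasure a b :=
      integral_nonneg_of_ae ((ae_betaMeasure_mem_Icc a b).mono fun x hx => pow_nonneg hx.1 _)
    have hjq : ((j + 1 : ℕ) : ℝ) ≤ q := by exact_mod_cast hj
    have hle : (a + (j + 1 : ℕ)) / (a + (j + 1 : ℕ) + b) ≤ (a + q) / (a + b) := by
      have : (0 : ℝ) ≤ (j + 1 : ℕ) := by positivity
      gcongr; linarith
    rw [integral_pow_succ_betaMeasure ha hb, pow_succ, ← mul_assoc, mul_comm]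
    exact mul_le_mul (ih (by omega)) hle (by positivity) (by positivity)

/-! ### Second order expansion of a power -/

/-- Multiplying the remainder by x + y creates only the extra term (n + 2) x^(n+1) y², and (n + 2)²
+ (n + 2) ≤ (n + 3)². -/
lemma abs_add_pow_sub_le (x y : ℝ) (n : ℕ) :
    |(x + y) ^ (n + 2) - x ^ (n + 2) - (n + 2) * x ^ (n + 1) * y|
      ≤ (n + 2) ^ 2 * (y ^ 2 * (|x| + |y|) ^ n) := by
  induction n with
  | zero =>
    rw [abs_le]; constructor <;> norm_num <;> nlinarith [sq_nonneg y]
  | succ n ih =>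
    have e : (x + y) ^ (n + 1 + 2) - x ^ (n + 1 + 2) - ((n + 1 : ℕ) + 2) * x ^ (n + 1 + 1) * y
        = (x + y) * ((x + y) ^ (n + 2) - x ^ (n + 2) - (n + 2) * x ^ (n + 1) * y)
          + (n + 2) * x ^ (n + 1) * y ^ 2 := by
      push_cast; ring
    have hx : |x| ^ (n + 1) ≤ (|x| + |y|) ^ (n + 1) := by gcongr; linarith [abs_nonneg y]
    rw [e]
    calc _ ≤ |x + y| * |(x + y) ^ (n + 2) - x ^ (n + 2) - (n + 2) * x ^ (n + 1) * y|
          + (n + 2) * |x| ^ (n + 1) * y ^ 2 := by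
            refine (abs_add_le _ _).trans (le_of_eq ?_)
            rw [abs_mul, abs_mul, abs_mul, abs_pow, abs_pow, sq_abs,
              abs_of_nonneg (by positivity : (0 : ℝ) ≤ (n : ℝ) + 2)]
      _ ≤ (|x| + |y|) * ((n + 2) ^ 2 * (y ^ 2 * (|x| + |y|) ^ n))
          + (n + 2) * (|x| + |y|) ^ (n + 1) * y ^ 2 := by
            gcongr; exact abs_add_le _ _
      _ = ((n + 2) ^ 2 + (n + 2)) * (y ^ 2 * (|x| + |y|) ^ (n + 1)) := by ring
      _ ≤ _ := by
            gcongr; push_cast; nlinarith [(Nat.cast_nonneg n : (0 : ℝ) ≤ n)]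

/-! ### Moment inequalities -/

section Moments

variable {Ω : Type*} [MeasurableSpace Ω] {P : Measure Ω} [IsProbabilityMeasure P]

/-- Monotonicity of L^p norms, obtained by integrating the weighted AM-GM inequality between |x|^q
and β^q. -/
lemma integral_abs_pow_le_of_integral_pow_le {X : Ω → ℝ} {β : ℝ} (hβ : 0 < β) {q j : ℕ}
    (hq : Even q) (hj : j ≤ q) (hXj : Integrable (fun ω => |X ω| ^ j) P)
    (hXq : Integrable (fun ω => X ω ^ q) P)
    (h : ∫ ω, X ω ^ q ∂P ≤ β ^ q) : ∫ ω, |X ω| ^ j ∂P ≤ β ^ j := by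
  rcases Nat.eq_zero_or_pos q with rfl | hq0
  · obtain rfl : j = 0 := by omega
    simp
  have hq' : (0 : ℝ) < q := by exact_mod_cast hq0
  have key : ∀ x : ℝ, |x| ^ j * β ^ (q - j) ≤
      (j / q : ℝ) * x ^ q + ((q - j : ℕ) / q : ℝ) * β ^ q := fun x => by
    have := Real.geom_mean_le_arith_mean2_weighted (w₁ := j / q) (w₂ := ((q - j : ℕ) : ℝ) / q)
      (p₁ := |x| ^ q) (p₂ := β ^ q) (by positivity) (by positivity) (by positivity)
      (by positivity) (by rw [Nat.cast_sub hj]; field_simp; ring)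
    rw [← Real.rpow_natCast_mul (abs_nonneg x), ← Real.rpow_natCast_mul hβ.le,
      mul_div_cancel₀ _ hq'.ne', mul_div_cancel₀ _ hq'.ne', Real.rpow_natCast,
      Real.rpow_natCast, hq.pow_abs] at this
    exact this
  have h1 : (∫ ω, |X ω| ^ j ∂P) * β ^ (q - j) ≤ β ^ j * β ^ (q - j) := by
    rw [← integral_mul_const, ← pow_add, Nat.add_sub_cancel' hj]
    calc _ ≤ ∫ ω, ((j / q : ℝ) * X ω ^ q + ((q - j : ℕ) / q : ℝ) * β ^ q) ∂P :=
          integral_mono (hXj.mul_const _) ((hXq.const_mul _).add (integrable_const _))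
            fun ω => key _
      _ = (j / q : ℝ) * (∫ ω, X ω ^ q ∂P) + ((q - j : ℕ) / q : ℝ) * β ^ q := by
          rw [integral_add (hXq.const_mul _) (integrable_const _), integral_const_mul]
          simp
      _ ≤ (j / q : ℝ) * β ^ q + ((q - j : ℕ) / q : ℝ) * β ^ q := by gcongr
      _ = β ^ q := by rw [Nat.cast_sub hj]; field_simp; ring
  exact le_of_mul_le_mul_right h1 (by positivity)

lemma two_mul_add_pow_le {w h : ℝ} (hw : 0 ≤ w) (hh : 0 ≤ h) (j : ℕ) :
    (2 * w + h) ^ (j + 2) ≤ 2 ^ (j + 1) * (2 ^ (j + 2) * w ^ (j + 2) + h ^ (j + 2)) := by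
  have := add_pow_le (by positivity : 0 ≤ 2 * w) hh (j + 2)
  rwa [mul_pow] at this

lemma integral_two_mul_add_pow_le {W : Ω → ℝ} (hWm : AEMeasurable W P)
    (hW : ∀ᵐ ω ∂P, W ω ∈ Set.Icc (0 : ℝ) 1) {h ρ : ℝ} (hh : 0 ≤ h) (hhρ : h ≤ ρ) {j : ℕ}
    (hmom : ∫ ω, W ω ^ (j + 2) ∂P ≤ h * ρ ^ (j + 1)) :
    ∫ ω, (2 * W ω + h) ^ (j + 2) ∂P ≤ 16 * h * ρ * (4 * ρ) ^ j := by
  have hρ : 0 ≤ ρ := hh.trans hhρ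
  have hI : Integrable (fun ω => W ω ^ (j + 2)) P :=
    Integrable.of_bound (by fun_prop) 1 (hW.mono fun ω hω => by
      rw [Real.norm_of_nonneg (pow_nonneg hω.1 _)]; exact pow_le_one₀ hω.1 hω.2)
  calc _ ≤ ∫ ω, 2 ^ (j + 1) * (2 ^ (j + 2) * W ω ^ (j + 2) + h ^ (j + 2)) ∂P := by
        refine integral_mono_of_nonneg (hW.mono fun ω hω => ?_)
          (((hI.const_mul _).add (integrable_const _)).const_mul _)
          (hW.mono fun ω hω => two_mul_add_pow_le hω.1 hh j)
        have := hω.1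
        simp only [Pi.zero_apply]; positivity
    _ = 2 ^ (j + 1) * (2 ^ (j + 2) * (∫ ω, W ω ^ (j + 2) ∂P) + h ^ (j + 2)) := by
        rw [integral_const_mul, integral_add (hI.const_mul _) (integrable_const _),
          integral_const_mul]
        simp
    _ ≤ 2 ^ (j + 1) * (2 ^ (j + 2) * (h * ρ ^ (j + 1)) + h * ρ ^ (j + 1)) := by
        rw [show h ^ (j + 2) = h * h ^ (j + 1) by ring]; gcongr
    _ = (2 ^ (j + 2) + 1) * (2 ^ (j + 1) * (h * ρ ^ (j + 1))) := by ring
    _ ≤ (2 ^ (j + 2) + 2 ^ (j + 2)) * (2 ^ (j + 1) * (h * ρ ^ (j + 1))) := by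
        gcongr; exact one_le_pow₀ (by norm_num)
    _ = 16 * h * ρ * (4 * ρ) ^ j := by
        rw [mul_pow, show (4 : ℝ) ^ j = 2 ^ j * 2 ^ j by rw [← mul_pow]; norm_num]; ring

/-- One step of the recursion `X' = (1 - W) X + (W - h) d` at the level of even moments. -/
lemma integral_pow_convex_step_le {X W : Ω → ℝ} (hXm : AEMeasurable X P) (hWm : AEMeasurable W P)
    (hXW : IndepFun X W P) (hX : ∀ᵐ ω ∂P, |X ω| ≤ 1) (hW : ∀ᵐ ω ∂P, W ω ∈ Set.Icc (0 : ℝ) 1)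
    {h ρ β d : ℝ} (hh : 0 ≤ h) (hhρ : h ≤ ρ) (hβ : 0 < β) (hd : |d| ≤ 1) {n : ℕ} (hn : Even n)
    (hEW : ∫ ω, W ω ∂P = h)
    (hmom : ∀ j ≤ n, ∫ ω, W ω ^ (j + 2) ∂P ≤ h * ρ ^ (j + 1))
    (hXβ : ∫ ω, X ω ^ (n + 2) ∂P ≤ β ^ (n + 2)) :
    ∫ ω, ((1 - W ω) * X ω + (W ω - h) * d) ^ (n + 2) ∂P
      ≤ (1 - (n + 2) * h) * ∫ ω, X ω ^ (n + 2) ∂P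
        + (n + 2) ^ 2 * (16 * h * ρ * (β + 4 * ρ) ^ n) := by
  have hh1 : h ≤ 1 := by
    rw [← hEW]
    calc _ ≤ ∫ _, (1 : ℝ) ∂P := integral_mono_of_nonneg (hW.mono fun ω hω => hω.1)
          (integrable_const _) (hW.mono fun ω hω => hω.2)
      _ = 1 := by simp
  have hXI : ∀ j, Integrable (fun ω => X ω ^ j) P := fun j =>
    Integrable.of_bound (by fun_prop) 1 (hX.mono fun ω hω => by
      rw [norm_pow]; exact pow_le_one₀ (norm_nonneg _) hω)
  have hXaI : ∀ j, Integrable (fun ω => |X ω| ^ j) P := fun j =>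
    Integrable.of_bound (by fun_prop) 1 (hX.mono fun ω hω => by
      rw [norm_pow, Real.norm_eq_abs, abs_abs]; exact pow_le_one₀ (abs_nonneg _) hω)
  have hWI : Integrable W P := Integrable.of_bound (by fun_prop) 1 (hW.mono fun ω hω => by
      rw [Real.norm_of_nonneg hω.1]; exact hω.2)
  have hYI : ∀ j, Integrable (fun ω => (2 * W ω + h) ^ j) P := fun j =>
    Integrable.of_bound (by fun_prop) (3 ^ j) (hW.mono fun ω hω => by
      have h0 := hω.1
      have h1 := hω.2
      rw [Real.norm_of_nonneg (by positivity)]; gcongr; linarith)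
  have hXWI : ∀ j, Integrable (fun ω => X ω ^ j * W ω) P := fun j =>
    (hXW.comp (measurable_id.pow_const j) measurable_id).integrable_mul (hXI j) hWI
  have hXYind : ∀ i j : ℕ, IndepFun (fun ω => |X ω| ^ i) (fun ω => (2 * W ω + h) ^ j) P :=
    fun i j => hXW.comp (φ := fun x => |x| ^ i) (ψ := fun w => (2 * w + h) ^ j)
      (by fun_prop) (by fun_prop)
  have hXYI : ∀ i j : ℕ, Integrable (fun ω => |X ω| ^ i * (2 * W ω + h) ^ j) P := fun i j =>
    (hXYind i j).integrable_mul (hXaI i) (hYI j)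
  have hXW_eq : ∀ j, ∫ ω, X ω ^ j * W ω ∂P = (∫ ω, X ω ^ j ∂P) * h := fun j => by
    rw [← hEW]
    exact (hXW.comp (measurable_id.pow_const j) measurable_id).integral_fun_mul_eq_mul_integral
      (hXI j).1 hWI.1
  -- With Δ = (W - h) d - W X the new value is X + Δ. The linear term is kept exact, since its
  -- d-part integrates to zero; only the remainder is bounded, through |Δ| ≤ 2W + h.
  have hpt : ∀ᵐ ω ∂P, ((1 - W ω) * X ω + (W ω - h) * d) ^ (n + 2) ≤
      X ω ^ (n + 2) + (n + 2) * (d * (X ω ^ (n + 1) * W ω - h * X ω ^ (n + 1))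
        - X ω ^ (n + 2) * W ω)
        + (n + 2) ^ 2 * ∑ j ∈ Finset.range (n + 1),
            (n.choose j : ℝ) * (|X ω| ^ j * (2 * W ω + h) ^ (n - j + 2)) := by
    filter_upwards [hX, hW] with ω hx hw
    have h0 := hw.1
    set Δ := (W ω - h) * d - W ω * X ω with hΔ
    have hT := (abs_le.1 (abs_add_pow_sub_le (X ω) Δ n)).2
    have hΔle : |Δ| ≤ 2 * W ω + h := by
      calc |Δ| ≤ |W ω - h| * |d| + |W ω| * |X ω| := by
            rw [hΔ, ← abs_mul, ← abs_mul]; exact abs_sub _ _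
        _ ≤ (W ω + h) * 1 + W ω * 1 := by
            rw [abs_of_nonneg h0]
            gcongr
            rw [abs_le]; constructor <;> linarith
        _ = _ := by ring
    have hsq : Δ ^ 2 * (|X ω| + |Δ|) ^ n ≤ ∑ j ∈ Finset.range (n + 1),
            (n.choose j : ℝ) * (|X ω| ^ j * (2 * W ω + h) ^ (n - j + 2)) := by
      calc _ ≤ (2 * W ω + h) ^ 2 * (|X ω| + (2 * W ω + h)) ^ n := by
            rw [← sq_abs]; gcongr
        _ = _ := by
            rw [add_pow (|X ω|), Finset.mul_sum]
            exact Finset.sum_congr rfl fun j _ => by ring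
    have e : (1 - W ω) * X ω + (W ω - h) * d = X ω + Δ := by rw [hΔ]; ring
    have e2 : (n + 2) * X ω ^ (n + 1) * Δ =
        (n + 2) * (d * (X ω ^ (n + 1) * W ω - h * X ω ^ (n + 1)) - X ω ^ (n + 2) * W ω) := by
      rw [hΔ]; ring
    rw [e]
    have := mul_le_mul_of_nonneg_left hsq (by positivity : (0 : ℝ) ≤ ((n : ℝ) + 2) ^ 2)
    linarith
  have hsumI : Integrable (fun ω => ∑ j ∈ Finset.range (n + 1),
      (n.choose j : ℝ) * (|X ω| ^ j * (2 * W ω + h) ^ (n - j + 2))) P :=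
    integrable_finsetSum _ fun j _ => (hXYI _ _).const_mul _
  have hdI : Integrable (fun ω => d * (X ω ^ (n + 1) * W ω - h * X ω ^ (n + 1))) P :=
    ((hXWI _).sub ((hXI _).const_mul h)).const_mul d
  have hlinI : Integrable (fun ω => (n + 2) * (d * (X ω ^ (n + 1) * W ω - h * X ω ^ (n + 1))
        - X ω ^ (n + 2) * W ω)) P :=
    (hdI.sub (hXWI _)).const_mul _
  have hquadI : Integrable (fun ω => X ω ^ (n + 2) + (n + 2) * (d * (X ω ^ (n + 1) * W ω -
      h * X ω ^ (n + 1)) - X ω ^ (n + 2) * W ω)) P := (hXI _).add hlinI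
  have hlin : ∫ ω, ((n : ℝ) + 2) * (d * (X ω ^ (n + 1) * W ω - h * X ω ^ (n + 1))
        - X ω ^ (n + 2) * W ω) ∂P = -((n + 2) * h * ∫ ω, X ω ^ (n + 2) ∂P) := by
    rw [integral_const_mul, integral_sub hdI (hXWI _), integral_const_mul, integral_sub (hXWI _) ((hXI _).const_mul h),
      integral_const_mul, hXW_eq, hXW_eq]
    ring
  have hsum : ∫ ω, ∑ j ∈ Finset.range (n + 1),
      (n.choose j : ℝ) * (|X ω| ^ j * (2 * W ω + h) ^ (n - j + 2)) ∂P
        ≤ 16 * h * ρ * (β + 4 * ρ) ^ n := by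
    -- Both sides are binomial sums, compared term by term: independence splits each expectation
    -- into a moment of X and one of 2W + h.
    rw [integral_finsetSum _ fun j _ => (hXYI _ _).const_mul _, add_pow, Finset.mul_sum]
    refine Finset.sum_le_sum fun j hj => ?_
    have hjn : j ≤ n := by simpa [Nat.lt_succ_iff] using hj
    rw [integral_const_mul, (hXYind j (n - j + 2)).integral_fun_mul_eq_mul_integral
      (hXaI j).1 (hYI _).1]
    have h1 := integral_abs_pow_le_of_integral_pow_le hβ (q := n + 2) (j := j)
      (hn.add even_two) (by omega) (hXaI j) (hXI _) hXβ
    have h2 := integral_two_mul_add_pow_le hWm hW hh hhρ (hmom (n - j) (by omega))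
    calc _ ≤ (n.choose j : ℝ) * (β ^ j * (16 * h * ρ * (4 * ρ) ^ (n - j))) := by
          refine mul_le_mul_of_nonneg_left (mul_le_mul h1 h2 ?_ (by positivity)) (by positivity)
          refine integral_nonneg_of_ae (hW.mono fun ω hω => ?_)
          have := hω.1
          simp only [Pi.zero_apply]; positivity
      _ = _ := by ring
  calc _ ≤ ∫ ω, (X ω ^ (n + 2) + (n + 2) * (d * (X ω ^ (n + 1) * W ω - h * X ω ^ (n + 1))
        - X ω ^ (n + 2) * W ω)
        + (n + 2) ^ 2 * ∑ j ∈ Finset.range (n + 1),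
            (n.choose j : ℝ) * (|X ω| ^ j * (2 * W ω + h) ^ (n - j + 2))) ∂P :=
        integral_mono_of_nonneg (Filter.Eventually.of_forall fun ω => (hn.add even_two).pow_nonneg _)
          (hquadI.add (hsumI.const_mul _)) hpt
    _ = (1 - (n + 2) * h) * (∫ ω, X ω ^ (n + 2) ∂P)
        + (n + 2) ^ 2 * ∫ ω, ∑ j ∈ Finset.range (n + 1),
            (n.choose j : ℝ) * (|X ω| ^ j * (2 * W ω + h) ^ (n - j + 2)) ∂P := by
        rw [integral_add hquadI (hsumI.const_mul _), integral_add (hXI _) hlinI,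
          hlin, integral_const_mul]
        ring
    _ ≤ _ := by gcongr

end Moments

/-! ### Weighted sums of the aggregated weights -/

/-- The sum `∑_{i ≤ m} λ_i W_m^i`. -/
noncomputable def weightedSum (lam : ℕ → ℝ) (w : ℕ → ℝ) (m : ℕ) : ℝ :=
  ∑ i ∈ Finset.range (m + 1), lam i * aggregatedWeight w m i

lemma aggregatedWeight_succ_of_le (w : ℕ → ℝ) {m i : ℕ} (hi : i ≤ m) :
    aggregatedWeight w (m + 1) i = (1 - w m) * aggregatedWeight w m i := by
  cases i with
  | zero => simp only [aggregatedWeight]; rw [Finset.prod_range_succ, mul_comm]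
  | succ i => simp only [aggregatedWeight]; rw [Finset.prod_Ico_succ_top (by omega)]; ring

lemma aggregatedWeight_self (w : ℕ → ℝ) (m : ℕ) : aggregatedWeight w (m + 1) (m + 1) = w m := by
  simp [aggregatedWeight]

lemma weightedSum_zero (lam w : ℕ → ℝ) : weightedSum lam w 0 = lam 0 := by
  simp [weightedSum, aggregatedWeight]

lemma weightedSum_succ (lam w : ℕ → ℝ) (m : ℕ) :
    weightedSum lam w (m + 1) = (1 - w m) * weightedSum lam w m + w m * lam (m + 1) := by
  rw [weightedSum, Finset.sum_range_succ, aggregatedWeight_self, weightedSum, Finset.mul_sum,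
    mul_comm (lam (m + 1))]
  congr 1
  refine Finset.sum_congr rfl fun i hi => ?_
  rw [aggregatedWeight_succ_of_le w (by simpa [Nat.lt_succ_iff] using hi)]
  ring

lemma weightedSum_congr (lam : ℕ → ℝ) {w v : ℕ → ℝ} {m : ℕ} (h : ∀ k < m, w k = v k) :
    weightedSum lam w m = weightedSum lam v m := by
  induction m with
  | zero => simp [weightedSum_zero]
  | succ m ih => rw [weightedSum_succ, weightedSum_succ, ih fun k hk => h k (by omega),
      h m (by omega)]

lemma weightedSum_mem_Icc {lam w : ℕ → ℝ} {m : ℕ} (hlam : ∀ i ≤ m, lam i ∈ Set.Icc (0 : ℝ) 1)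
    (hw : ∀ k < m, w k ∈ Set.Icc (0 : ℝ) 1) : weightedSum lam w m ∈ Set.Icc (0 : ℝ) 1 := by
  induction m with
  | zero => rw [weightedSum_zero]; exact hlam 0 le_rfl
  | succ m ih =>
    rw [weightedSum_succ]
    have hwm := hw m (by omega)
    exact convex_Icc (0 : ℝ) 1 (ih (fun i hi => hlam i (by omega)) fun k hk => hw k (by omega))
      (hlam (m + 1) le_rfl) (by linarith [hwm.2]) hwm.1 (by ring)

lemma aggregatedWeight_mem_Icc {w : ℕ → ℝ} {m i : ℕ} (hi : i ≤ m)
    (hw : ∀ k < m, w k ∈ Set.Icc (0 : ℝ) 1) : aggregatedWeight w m i ∈ Set.Icc (0 : ℝ) 1 := by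
  classical
  -- A single weight is the weighted sum for an indicator λ.
  have := weightedSum_mem_Icc (lam := fun j => if j = i then 1 else 0) (m := m)
    (fun j _ => by split_ifs <;> simp) hw
  simpa [weightedSum, Nat.lt_succ_iff.2 hi] using this

/-! ### Measurability and independence of the weighted sums -/

section Measurability

variable {Ω : Type*} [MeasurableSpace Ω]

lemma measurable_weightedSum (lam : ℕ → ℝ) {w : ℕ → Ω → ℝ} {m : ℕ}
    (hw : ∀ k < m, Measurable (w k)) : Measurable fun ω => weightedSum lam (fun k => w k ω) m := by
  induction m with
  | zero => simp [weightedSum_zero]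
  | succ m ih =>
    simp only [weightedSum_succ]
    have := ih fun k hk => hw k (by omega)
    have := hw m (by omega)
    fun_prop

lemma aemeasurable_weightedSum (lam : ℕ → ℝ) {P : Measure Ω} {w : ℕ → Ω → ℝ} {m : ℕ}
    (hw : ∀ k < m, AEMeasurable (w k) P) :
    AEMeasurable (fun ω => weightedSum lam (fun k => w k ω) m) P := by
  induction m with
  | zero => simp [weightedSum_zero]
  | succ m ih =>
    simp only [weightedSum_succ]
    have := ih fun k hk => hw k (by omega)
    have := hw m (by omega)
    fun_prop

lemma aemeasurable_aggregatedWeight {P : Measure Ω} {w : ℕ → Ω → ℝ} {m i : ℕ} (hi : i ≤ m)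
    (hw : ∀ k < m, AEMeasurable (w k) P) :
    AEMeasurable (fun ω => aggregatedWeight (fun k => w k ω) m i) P := by
  classical
  have := aemeasurable_weightedSum (fun j => if j = i then 1 else 0) hw
  simpa [weightedSum, Nat.lt_succ_iff.2 hi] using this

lemma indepFun_weightedSum (lam : ℕ → ℝ) {P : Measure Ω} {w : ℕ → Ω → ℝ} {m : ℕ}
    (hw : ∀ k < m + 1, AEMeasurable (w k) P)
    (hind : iIndepFun (fun (k : Fin (m + 1)) (ω : Ω) => w k ω) P) :
    IndepFun (fun ω => weightedSum lam (fun k => w k ω) m) (w m) P := by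
  classical
  have h := hind.indepFun_finset₀ (Finset.univ.erase (Fin.last m)) {Fin.last m}
    (by simp) (fun i => hw i i.2)
  -- The default 0 is never read: the sum at time m depends only on coordinates k < m.
  let g : ℕ → ((Finset.univ.erase (Fin.last m) : Finset (Fin (m + 1))) → ℝ) → ℝ := fun k v =>
    if hk : k < m then v ⟨⟨k, by omega⟩, by simp [Fin.ext_iff]; omega⟩ else 0
  have hg : ∀ k, Measurable (g k) := fun k => by
    by_cases hk : k < m
    · simp only [g, hk, dif_pos]; exact measurable_pi_apply _
    · simp only [g, hk, dif_neg, not_false_eq_true]; exact measurable_const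
  have hψ : Measurable fun v : ({Fin.last m} : Finset (Fin (m + 1))) → ℝ =>
      v ⟨Fin.last m, by simp⟩ := measurable_pi_apply _
  have h2 := h.comp (φ := fun v => weightedSum lam (fun k => g k v) m)
    (ψ := fun v => v ⟨Fin.last m, by simp⟩) (measurable_weightedSum lam fun k _ => hg k) hψ
  have e : (fun ω => weightedSum lam (fun k => w k ω) m) =
      (fun v => weightedSum lam (fun k => g k v) m) ∘
        (fun a (i : (Finset.univ.erase (Fin.last m) : Finset (Fin (m + 1)))) => w i a) := by
    ext ω
    exact weightedSum_congr lam fun k hk => by simp [g, hk]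
  rw [e]
  exact h2

lemma ae_forall_mem_Icc_of_hasLaw_betaMeasure {P : Measure Ω} {w : ℕ → Ω → ℝ}
    {a b : ℕ → ℝ} {m : ℕ}
    (hlaw : ∀ k < m, HasLaw (w k) (betaMeasure (a k) (b k)) P) :
    ∀ᵐ ω ∂P, ∀ k < m, w k ω ∈ Set.Icc (0 : ℝ) 1 :=
  ae_all_iff.2 fun k => Filter.eventually_imp_distrib_left.2 fun hk =>
    ((hlaw k hk).ae_iff (p := fun x => x ∈ Set.Icc (0 : ℝ) 1)
      (measurable_mem.2 measurableSet_Icc)).2 (ae_betaMeasure_mem_Icc _ _)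

end Measurability

/-! ### Even moments of the centred weighted sum -/

/-- With p = r + 1 and v = 384 p ρ, the constant 384 makes the noise at most (p h / 2) v^p, a
quarter of the contraction 2 p h v^p. The remaining gain 3/2 p h exceeds p/(M + 1), the relative
decrease needed to pass from M to M + 1. -/
lemma moment_recursion_le {r : ℕ} {u u' h ρ D M : ℝ} (hD : 0 < D) (hM : 1 ≤ M)
    (hρ : ρ = D / M) (hh : 2 / M ≤ h) (hhρ : h ≤ ρ) (hu'1 : u' ≤ 1)
    (hu : u ≤ (384 * (r + 1) * D / M) ^ (r + 1))
    (hu' : u' ≤ (1 - 2 * (r + 1) * h) * u + (2 * (r + 1)) ^ 2 *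
      (16 * h * ρ * (√(384 * (r + 1) * D / M) + 4 * ρ) ^ (2 * r))) :
    u' ≤ (384 * (r + 1) * D / (M + 1)) ^ (r + 1) := by
  have hM0 : 0 < M := by linarith
  have hρ0 : 0 < ρ := hρ ▸ div_pos hD hM0
  have hh0 : 0 < h := lt_of_lt_of_le (by positivity) hh
  -- If the target is at least 1, u' ≤ 1 suffices. Otherwise v ≤ 2, so p ρ and p h are small and the
  -- factor 1 - 2 p h is nonnegative.
  obtain hbig | hsmall := le_or_gt 1 (384 * (r + 1) * D / (M + 1))
  · exact hu'1.trans (one_le_pow₀ hbig)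
  set p : ℝ := r + 1 with hp
  have hp1 : 1 ≤ p := by rw [hp]; linarith [(Nat.cast_nonneg r : (0 : ℝ) ≤ r)]
  have hv : 384 * p * D / M = 384 * p * ρ := by rw [hρ]; ring
  rw [hv] at hu hu'
  set v := 384 * p * ρ with hvdef
  have hv0 : 0 < v := by positivity
  have hv2 : v ≤ 2 := by
    rw [div_lt_one (by linarith)] at hsmall
    rw [← hv, div_le_iff₀ hM0]; linarith
  have hpρ : p * ρ ≤ 1 / 192 := by linarith
  have hph : p * h ≤ 1 / 192 := (mul_le_mul_of_nonneg_left hhρ (by linarith)).trans hpρ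
  -- The shift by 4ρ costs a relative factor 1 + 1/(2p), whose 2r-th power stays below e < 3.
  have hβ : 4 * ρ ≤ √v * (1 / (2 * p)) := by
    rw [mul_one_div, le_div_iff₀ (by positivity)]
    apply Real.le_sqrt_of_sq_le
    have : 0 < p * ρ := by positivity
    rw [hvdef]; nlinarith
  have hpow : (√v + 4 * ρ) ^ (2 * r) ≤ 3 * v ^ r := by
    have h1 : (1 + 1 / (2 * p)) ^ (2 * r) ≤ 3 := by
      calc (1 + 1 / (2 * p)) ^ (2 * r) ≤ (1 + 1 / (2 * p)) ^ (2 * (r + 1)) :=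
            pow_le_pow_right₀ (by simp; positivity) (by omega)
        _ ≤ (Real.exp (1 / (2 * p))) ^ (2 * (r + 1)) := by
            gcongr; rw [add_comm]; exact Real.add_one_le_exp _
        _ = Real.exp 1 := by
            rw [← Real.exp_nat_mul]; congr 1; push_cast; rw [← hp]; field_simp
        _ ≤ 3 := by linarith [Real.exp_one_lt_d9]
    calc _ ≤ (√v * (1 + 1 / (2 * p))) ^ (2 * r) := by
          gcongr; linarith
      _ = (1 + 1 / (2 * p)) ^ (2 * r) * v ^ r := by
          rw [mul_pow, pow_mul (√v), Real.sq_sqrt hv0.le, mul_comm]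
      _ ≤ _ := by gcongr
  calc u' ≤ (1 - 2 * p * h) * v ^ (r + 1) + (2 * p) ^ 2 * (16 * h * ρ * (3 * v ^ r)) := by
        refine hu'.trans (add_le_add (mul_le_mul_of_nonneg_left hu (by linarith)) ?_)
        gcongr
    _ = (1 - 3 / 2 * p * h) * v ^ (r + 1) := by rw [pow_succ, hvdef]; ring
    _ ≤ (1 + ((r + 1 : ℕ) : ℝ) * (-(1 / (M + 1)))) * v ^ (r + 1) := by
        push_cast
        rw [← hp]
        have h1 : p * (1 / (M + 1)) ≤ p * (3 / 2 * h) := by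
          gcongr
          calc 1 / (M + 1) ≤ 2 / M := by gcongr <;> linarith
            _ ≤ 3 / 2 * h := by linarith
        gcongr; linarith
    -- Bernoulli's inequality; 1 - 1/(M + 1) = M/(M + 1) then turns the denominator M into M + 1.
    _ ≤ (1 + -(1 / (M + 1))) ^ (r + 1) * v ^ (r + 1) := by
        gcongr
        refine one_add_mul_le_pow ?_ _
        have : 1 / (M + 1) ≤ 1 := by rw [div_le_one (by linarith)]; linarith
        linarith
    _ = _ := by
        rw [← mul_pow, hvdef, hρ]; congr 1; field_simp; ring

section Concentration

variable {Ω : Type*} [MeasurableSpace Ω] {P : Measure Ω} [IsProbabilityMeasure P]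

/-- Induction on m at a fixed moment order, so D stays constant and only the denominator moves. At m
= 0 the sum is deterministic. -/
lemma integral_pow_weightedSum_sub_le {H n₀ m : ℕ} {κ : ℝ} {w : ℕ → Ω → ℝ} {lam : ℕ → ℝ}
    (hH : 1 ≤ H) (hn₀ : 1 ≤ n₀) (hκ : 0 < κ)
    (hind : iIndepFun (fun (k : Fin m) (ω : Ω) => w k ω) P)
    (hlaw : ∀ k < m, HasLaw (w k) (betaMeasure (((H : ℝ) + 1) / κ) (((n₀ : ℝ) + k) / κ)) P)
    (hlam : ∀ i ≤ m, lam i ∈ Set.Icc (0 : ℝ) 1) (r : ℕ) :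
    ∫ ω, (weightedSum lam (fun k => w k ω) m
        - ∫ ω', weightedSum lam (fun k => w k ω') m ∂P) ^ (2 * r + 2) ∂P
      ≤ (384 * (r + 1) * (H + 1 + 2 * (r + 1) * κ) / (H + 1 + n₀ + m)) ^ (r + 1) := by
  have hbase : ∀ m : ℕ, (0 : ℝ) < 384 * (r + 1) * (H + 1 + 2 * (r + 1) * κ) / (H + 1 + n₀ + m) :=
    fun m => by positivity
  induction m with
  | zero =>
    simp only [weightedSum_zero, integral_const, probReal_univ, one_smul, sub_self]
    rw [zero_pow (by omega)]
    exact pow_nonneg (hbase 0).le _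
  | succ m ih =>
    have hwm : ∀ k < m + 1, AEMeasurable (w k) P := fun k hk => (hlaw k hk).aemeasurable
    have hwall : ∀ᵐ ω ∂P, ∀ k < m + 1, w k ω ∈ Set.Icc (0 : ℝ) 1 :=
      ae_forall_mem_Icc_of_hasLaw_betaMeasure hlaw
    set S : Ω → ℝ := fun ω => weightedSum lam (fun k => w k ω) m with hS
    set W : Ω → ℝ := w m with hWdef
    set μ : ℝ := ∫ ω, S ω ∂P with hμ
    have hSm : AEMeasurable S P := aemeasurable_weightedSum lam fun k hk => hwm k (by omega)
    have hWm : AEMeasurable W P := hwm m (by omega)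
    have hS01 : ∀ᵐ ω ∂P, S ω ∈ Set.Icc (0 : ℝ) 1 := hwall.mono fun ω hω =>
      weightedSum_mem_Icc (fun i hi => hlam i (by omega)) fun k hk => hω k (by omega)
    have hW01 : ∀ᵐ ω ∂P, W ω ∈ Set.Icc (0 : ℝ) 1 :=
      hwall.mono fun ω hω => hω m (by omega)
    have hSI : Integrable S P := Integrable.of_mem_Icc 0 1 hSm hS01
    have hWI : Integrable W P := Integrable.of_mem_Icc 0 1 hWm hW01
    have hμ01 : μ ∈ Set.Icc (0 : ℝ) 1 :=
      (convex_Icc (0 : ℝ) 1).integral_mem isClosed_Icc hS01 hSI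
    have hSW : IndepFun S W P := indepFun_weightedSum lam hwm hind
    set a : ℝ := ((H : ℝ) + 1) / κ with ha
    set b : ℝ := ((n₀ : ℝ) + m) / κ with hb
    have ha0 : 0 < a := by positivity
    have hb0 : 0 < b := by positivity
    set h : ℝ := a / (a + b) with hh
    set ρ : ℝ := (a + (2 * r + 2 : ℕ)) / (a + b) with hρ
    have hlawW : HasLaw W (betaMeasure a b) P := hlaw m (by omega)
    have hEW : ∫ ω, W ω ∂P = h := by
      rw [hlawW.integral_eq, integral_betaMeasure ha0 hb0]
    have hmom : ∀ j ≤ 2 * r, ∫ ω, W ω ^ (j + 2) ∂P ≤ h * ρ ^ (j + 1) := fun j hj => by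
      have := hlawW.integral_comp (f := fun x => x ^ (j + 2)) (by fun_prop)
      simp only [Function.comp_def] at this
      rw [this]
      exact integral_pow_betaMeasure_le ha0 hb0 (by omega)
    have hSWI : Integrable (fun ω => S ω * W ω) P := hSW.integrable_mul hSI hWI
    have hμ' : ∫ ω, weightedSum lam (fun k => w k ω) (m + 1) ∂P
        = μ - μ * h + h * lam (m + 1) := by
      calc _ = ∫ ω, (S ω - S ω * W ω + W ω * lam (m + 1)) ∂P := by
            congr 1; ext ω; rw [weightedSum_succ]; simp only [hS, hWdef]; ring
        _ = _ := by
            rw [integral_add (f := fun ω => S ω - S ω * W ω) (hSI.sub hSWI) (hWI.mul_const _),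
              integral_sub hSI hSWI, integral_mul_const,
              hSW.integral_fun_mul_eq_mul_integral hSI.1 hWI.1, hEW]
    have hX' : ∀ ω, weightedSum lam (fun k => w k ω) (m + 1)
        - ∫ ω', weightedSum lam (fun k => w k ω') (m + 1) ∂P
        = (1 - W ω) * (S ω - μ) + (W ω - h) * (lam (m + 1) - μ) := fun ω => by
      rw [hμ', weightedSum_succ]; simp only [hS, hWdef]; ring
    have hX'1 : ∀ᵐ ω ∂P, |(1 - W ω) * (S ω - μ) + (W ω - h) * (lam (m + 1) - μ)| ≤ 1 := by
      have h01 : ∀ᵐ ω ∂P, weightedSum lam (fun k => w k ω) (m + 1) ∈ Set.Icc (0 : ℝ) 1 :=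
        hwall.mono fun ω hω => weightedSum_mem_Icc hlam hω
      have hμ01' : ∫ ω, weightedSum lam (fun k => w k ω) (m + 1) ∂P ∈ Set.Icc (0 : ℝ) 1 :=
        (convex_Icc (0 : ℝ) 1).integral_mem isClosed_Icc h01
          (Integrable.of_mem_Icc 0 1 (aemeasurable_weightedSum lam hwm) h01)
      filter_upwards [h01] with ω hω
      rw [← hX', abs_le]
      constructor <;> linarith [hω.1, hω.2, hμ01'.1, hμ01'.2]
    have ih' := ih (hind.precomp (Fin.castSucc_injective m)) (fun k hk => hlaw k (by omega))
      fun i hi => hlam i (by omega)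
    simp only [hX']
    have hM : ∀ c : ℝ, (a + c) / (a + b) = (H + 1 + c * κ) / (H + 1 + n₀ + m) := fun c => by
      rw [ha, hb]; field_simp; ring
    have hρ' : ρ = (H + 1 + 2 * (r + 1) * κ) / (H + 1 + n₀ + m) := by
      rw [hρ, hM]; push_cast; ring
    have hh' : h = (H + 1) / (H + 1 + n₀ + m) := by simpa using hM 0
    have hhρ : h ≤ ρ := by
      rw [hh', hρ']
      have : 0 ≤ 2 * ((r : ℝ) + 1) * κ := by positivity
      exact div_le_div_of_nonneg_right (by linarith) (by positivity)
    have hH' : (1 : ℝ) ≤ H := by exact_mod_cast hH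
    have hstep := integral_pow_convex_step_le (X := fun ω => S ω - μ) (d := lam (m + 1) - μ)
      (hSm.sub_const μ) hWm (hSW.comp (measurable_id.sub_const μ) measurable_id)
      (hS01.mono fun ω hω => by
        rw [abs_le]; constructor <;> linarith [hω.1, hω.2, hμ01.1, hμ01.2])
      hW01 (by positivity) hhρ (Real.sqrt_pos.2 (hbase m))
      (by have := hlam (m + 1) le_rfl
          rw [abs_le]; constructor <;> linarith [this.1, this.2, hμ01.1, hμ01.2])
      (even_two_mul r) hEW hmom
      (by rw [show 2 * r + 2 = 2 * (r + 1) by ring, pow_mul, Real.sq_sqrt (hbase m).le]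
          exact ih')
    have hfin := moment_recursion_le (D := H + 1 + 2 * (r + 1) * κ) (M := H + 1 + n₀ + m)
      (u := ∫ ω, (S ω - μ) ^ (2 * r + 2) ∂P) (by positivity)
      (by linarith [(Nat.cast_nonneg n₀ : (0 : ℝ) ≤ n₀), (Nat.cast_nonneg m : (0 : ℝ) ≤ m)]) hρ'
      (by rw [hh']; gcongr; linarith) hhρ ?_ ih' (hstep.trans (le_of_eq ?_))
    · convert hfin using 2; push_cast; ring
    · calc _ ≤ ∫ _, (1 : ℝ) ∂P := by
            refine integral_mono_of_nonneg
              (Filter.Eventually.of_forall fun ω => ((even_two_mul r).add even_two).pow_nonneg _)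
              (integrable_const _) (hX'1.mono fun ω hω => ?_)
            beta_reduce
            rw [← ((even_two_mul r).add even_two).pow_abs]
            exact pow_le_one₀ (abs_nonneg _) hω
        _ = 1 := by simp
    · push_cast; ring

/-- Markov's inequality for even moments, with the threshold measured in units of `e`. -/
lemma one_sub_exp_neg_le_measureReal_abs_le {X : Ω → ℝ} {q : ℕ} {v t L : ℝ}
    (hq : Even q) (hX : Integrable (fun ω => X ω ^ q) P) (hv : 0 < v)
    (hm : ∫ ω, X ω ^ q ∂P ≤ v ^ q) (ht : Real.exp 1 * v ≤ t) (hL : L ≤ q) :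
    1 - Real.exp (-L) ≤ P.real {ω | |X ω| ≤ t} := by
  have ht0 : 0 < t := lt_of_lt_of_le (by positivity) ht
  have hmar := mul_meas_ge_le_integral_of_nonneg
    (Filter.Eventually.of_forall fun ω => hq.pow_nonneg (X ω)) hX (t ^ q)
  have hsub : {ω | |X ω| ≤ t}ᶜ ⊆ {ω | t ^ q ≤ X ω ^ q} := fun ω hω => by
    have hω' : t < |X ω| := by simpa using hω
    simp only [Set.mem_ofPred_eq]
    rw [← hq.pow_abs (X ω)]
    gcongr
  have hbad : P.real {ω | t ^ q ≤ X ω ^ q} ≤ Real.exp (-L) := by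
    have h1 : v ^ q ≤ t ^ q * Real.exp (-L) := by
      calc v ^ q = (Real.exp 1 * v) ^ q * Real.exp (-q) := by
            rw [mul_pow, ← Real.exp_nat_mul, mul_one, mul_right_comm, ← Real.exp_add]; simp
        _ ≤ _ := by gcongr
    exact le_of_mul_le_mul_left (hmar.trans (hm.trans h1)) (by positivity)
  -- Subadditivity suffices and requires no measurability of the event.
  have huniv : 1 ≤ P.real {ω | |X ω| ≤ t} + P.real {ω | |X ω| ≤ t}ᶜ := by
    rw [← probReal_univ (μ := P), ← Set.union_compl_self {ω | |X ω| ≤ t}]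
    exact measureReal_union_le _ _
  linarith [measureReal_mono (μ := P) hsub]

end Concentration

/-- The deviation scale supplied by the moment bound of order `2 ⌈L⌉` is dominated by
`(H + 1) κ² L³ / N`. -/
lemma moment_scale_le {κ₀ κ L x y N : ℝ} (hκ₀ : 0 < κ₀) (hκ : κ₀ ≤ κ) (hL : 1 / 2 ≤ L)
    (hx : 1 ≤ x) (hN : 0 < N) (hy0 : 0 ≤ y) (hy : y ≤ 3 * L) :
    384 * y * (x + 2 * y * κ) / (N + 1)
      ≤ 1152 * (4 / κ₀ ^ 2 + 12 / κ₀) * (x * κ ^ 2 * L ^ 3 / N) := by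
  have hκ' : 0 < κ := by linarith
  have hL0 : 0 < L := by linarith
  have e1 : 1 ≤ κ / κ₀ := by rwa [one_le_div hκ₀]
  have e2 : 1 ≤ 2 * L := by linarith
  calc _ ≤ 384 * (3 * L) * (x + 2 * (3 * L) * κ) / N := by gcongr; linarith
    _ = 1152 * (L * (x * 1 + 1 * 6 * (L * κ)) / N) := by ring
    -- Factors κ/κ₀ ≥ 1, 2L ≥ 1 and x ≥ 1 are inserted until both terms carry x κ² L²; they produce
    -- 4/κ₀² and 12/κ₀.
    _ ≤ 1152 * (L * (x * ((κ / κ₀) ^ 2 * (2 * L) ^ 2) + x * 6 * (L * κ * (κ / κ₀) * (2 * L))) / N) := by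
        have e3 : 1 ≤ (κ / κ₀) ^ 2 * (2 * L) ^ 2 :=
          one_le_mul_of_one_le_of_one_le (one_le_pow₀ e1) (one_le_pow₀ e2)
        have e4 : L * κ ≤ L * κ * (κ / κ₀) * (2 * L) := by
          rw [mul_assoc (L * κ)]
          exact le_mul_of_one_le_right (by positivity) (one_le_mul_of_one_le_of_one_le e1 e2)
        gcongr
    _ = _ := by field_simp; ring

theorem mainTheorem3 (κ₀ : ℝ) (hκ₀ : 0 < κ₀) :
    ∃ c₁ c₂ : ℝ, 0 < c₁ ∧ 0 < c₂ ∧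
      ∀ (Ω : Type*) [MeasurableSpace Ω] (P : Measure Ω) [IsProbabilityMeasure P]
        (H n₀ m T : ℕ) (κ δ : ℝ) (w : ℕ → Ω → ℝ) (lam : ℕ → ℝ),
        1 ≤ H → 1 ≤ n₀ → κ₀ ≤ κ → 0 < δ → δ < 1 → 2 * δ ≤ (T : ℝ) →
        iIndepFun (fun (k : Fin m) (ω : Ω) => w k ω) P →
        (∀ k < m, HasLaw (w k) (betaMeasure (((H : ℝ) + 1) / κ) (((n₀ : ℝ) + k) / κ)) P) →
        (∀ i ≤ m, 0 ≤ lam i ∧ lam i ≤ 1) →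
        1 - δ / T ≤
          P.real {ω | |∑ i ∈ Finset.range (m + 1),
              lam i * (aggregatedWeight (fun k => w k ω) m i
                - ∫ ω', aggregatedWeight (fun k => w k ω') m i ∂P)|
            ≤ c₁ * √(((H : ℝ) + 1) * κ ^ 2 * Real.log (T / δ) ^ 3 / ((H : ℝ) + n₀ + m))
              + c₂ * (((H : ℝ) + 1) * κ * Real.log (T / δ) ^ 2 / ((H : ℝ) + n₀ + m))} := by
  -- The factor e is the Markov threshold, the root comes from `moment_scale_le`. The square-root
  -- term alone suffices, so any positive c₂ would do.
  refine ⟨Real.exp 1 * √(1152 * (4 / κ₀ ^ 2 + 12 / κ₀)), 1, by positivity, one_pos, ?_⟩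
  intro Ω _ P _ H n₀ m T κ δ w lam hH hn₀ hκ hδ hδ1 hT hind hlaw hlam
  have hκ' : 0 < κ := by linarith
  have hT0 : (0 : ℝ) < T := by linarith
  set L := Real.log (T / δ) with hLdef
  have hL : 1 / 2 ≤ L := by
    have h2 : (2 : ℝ) ≤ T / δ := by rwa [le_div_iff₀ hδ]
    linarith [Real.log_two_gt_d9, Real.log_le_log two_pos h2]
  have hexpL : Real.exp (-L) = δ / T := by
    rw [Real.exp_neg, hLdef, Real.exp_log (by positivity), inv_div]
  have hwm : ∀ k < m, AEMeasurable (w k) P := fun k hk => (hlaw k hk).aemeasurable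
  have hwall : ∀ᵐ ω ∂P, ∀ k < m, w k ω ∈ Set.Icc (0 : ℝ) 1 :=
    ae_forall_mem_Icc_of_hasLaw_betaMeasure hlaw
  set S : Ω → ℝ := fun ω => weightedSum lam (fun k => w k ω) m with hS
  set μ : ℝ := ∫ ω, S ω ∂P with hμ
  have hS01 : ∀ᵐ ω ∂P, S ω ∈ Set.Icc (0 : ℝ) 1 := hwall.mono fun ω hω =>
    weightedSum_mem_Icc hlam hω
  have hSm : AEMeasurable S P := aemeasurable_weightedSum lam hwm
  have hμ01 : μ ∈ Set.Icc (0 : ℝ) 1 :=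
    (convex_Icc (0 : ℝ) 1).integral_mem isClosed_Icc hS01 (Integrable.of_mem_Icc 0 1 hSm hS01)
  have hsum : ∀ ω, ∑ i ∈ Finset.range (m + 1), lam i * (aggregatedWeight (fun k => w k ω) m i
      - ∫ ω', aggregatedWeight (fun k => w k ω') m i ∂P) = S ω - μ := fun ω => by
    have hI : ∀ i ∈ Finset.range (m + 1),
        Integrable (fun ω' => aggregatedWeight (fun k => w k ω') m i) P := fun i hi => by
      have him : i ≤ m := by simpa [Nat.lt_succ_iff] using hi
      exact Integrable.of_mem_Icc 0 1 (aemeasurable_aggregatedWeight him hwm)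
        (hwall.mono fun ω hω => aggregatedWeight_mem_Icc him hω)
    simp only [mul_sub, Finset.sum_sub_distrib, hS, hμ, weightedSum]
    rw [integral_finsetSum _ fun i hi => (hI i hi).const_mul _]
    simp only [integral_const_mul]
  simp only [hsum]
  obtain ⟨r, hr⟩ : ∃ r, ⌈L⌉₊ = r + 1 :=
    Nat.exists_eq_succ_of_ne_zero (Nat.ceil_pos.2 (by linarith)).ne'
  have hr1 : L ≤ r + 1 := by have := Nat.le_ceil L; rw [hr] at this; exact_mod_cast this
  -- ⌈L⌉ < L + 1 ≤ 3L, because L ≥ 1/2.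
  have hr2 : (r : ℝ) + 1 ≤ 3 * L := by
    have := Nat.ceil_lt_add_one (show 0 ≤ L by linarith)
    rw [hr] at this; push_cast at this; linarith
  have hmoment := integral_pow_weightedSum_sub_le hH hn₀ hκ' hind hlaw hlam r
  have hscale := moment_scale_le (x := H + 1) (y := r + 1) (N := H + n₀ + m) hκ₀ hκ hL
    (by linarith [(Nat.cast_nonneg H : (0 : ℝ) ≤ H)]) (by positivity) (by positivity) hr2
  rw [show (H : ℝ) + n₀ + m + 1 = H + 1 + n₀ + m by ring] at hscale
  set v := 384 * ((r : ℝ) + 1) * (H + 1 + 2 * (r + 1) * κ) / (H + 1 + n₀ + m) with hv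
  have hv0 : 0 < v := by positivity
  rw [← hexpL]
  refine one_sub_exp_neg_le_measureReal_abs_le (q := 2 * r + 2) (v := √v)
    ((even_two_mul r).add even_two) ?_ (Real.sqrt_pos.2 hv0) ?_ ?_ ?_
  · refine Integrable.of_bound (by fun_prop) 1 (hS01.mono fun ω hω => ?_)
    rw [norm_pow]
    refine pow_le_one₀ (norm_nonneg _) ?_
    rw [Real.norm_eq_abs, abs_le]
    constructor <;> linarith [hω.1, hω.2, hμ01.1, hμ01.2]
  · rw [show √v ^ (2 * r + 2) = v ^ (r + 1) by
      rw [show 2 * r + 2 = 2 * (r + 1) by ring, pow_mul, Real.sq_sqrt hv0.le]]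
    exact hmoment
  · have hrest : 0 ≤ 1 * (((H : ℝ) + 1) * κ * L ^ 2 / ((H : ℝ) + n₀ + m)) := by positivity
    have := Real.sqrt_le_sqrt hscale
    rw [Real.sqrt_mul (by positivity)] at this
    nlinarith [Real.exp_pos 1]
  · push_cast; linarith
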